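/- Let $\mathcal G$ be a weighted directed graph on $n\ge 1$ nodes with adjacency matrix $(a_{ij})$, where $a_{ij}\ge 0$, $a_{ii}=0$, and $a_{ij}>0$ if and only if there is an edge from $j$ to $i$; let $\mathcal N_i=\{j: a_{ij}>0\}$ and let $\mathcal L=(l_{ij})$ be its Laplacian, $l_{ii}=\sum_{k\ne i}a_{ik}$ and $l_{ij}=-a_{ij}$ for $j\neq i$. Let $C=(c_{kl})\in\mathbb R^{d\times d}$ have $1$ as a semi-simple eigenvalue of multiplicity $p\ge 1$, and let all its other (complex) eigenvalues have real part less than $1$. Suppose that $l_{ii}\le 1$ for all $i$, that $c_{kk}>0$ for all $k$, and that $\|C\|_\infty=\max_k\sum_l|c_{kl}|=1$. Consider the opinion dynamics $$\dot x_i(t)=\sum_{j\in\mathcal N_i}a_{ij}\,C\,(x_j(t)-x_i(t))+(C-I_d)\,x_i(t),\qquad t\ge 0,\ i=1,\dots,n,$$ with $x_i(t)\in\mathbb R^d$, and write $x=(x_1,\dots,x_n)$. Then the network reaches a consensus globally exponentially, that is, there are constants $K$ and $\alpha>0$ such that $\|x_i(t)-x_j(t)\|\le K e^{-\alpha t}\|x(0)\|$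 for all solutions $x$, all $t\ge0$ and all $i,j$, if and only if $\mathcal G$ has a directed spanning tree (a subset of the edges forming a directed tree in which one root node has no parent, every other node has exactly one parent, and every node is reachable from the root). Moreover, suppose that $\mathcal G$ has a directed spanning tree. Then there is a unique vector $\gamma\ge 0$ with $\gamma^\top\mathcal L=0$ and $\sum_i\gamma_i=1$. If $\zeta_1,\dots,\zeta_p$ and $\xi_1^\top,\dots,\xi_p^\top$ are right and left eigenvectors of $C$ for the eigenvalue $1$ with $\xi_r^\top\zeta_s=\delta_{rs}$ for all $r,s$, then every solution satisfies $$\lim_{t\to\infty}x_i(t)=\Big(\sum_{r=1}^p\zeta_r\xi_r^\top\Big)\sum_{j=1}^n\gamma_j x_j(0)\qquad\text{for all } i,$$ and this convergence is exponential: there are constants $K$ and $\alpha>0$ such that the norm of the difference between $x_i(t)$ and this limit is at most $Ke^{-\alpha t}\|x(0)\|$ for all solutions $x$, all $t\ge 0$ and all $i$. -/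

import Mathlib

open scoped Matrix

/-- A weighted directed graph on the nodes `Fin n`. `Edge j i` is the ordered edge from `j` to `i`
(individual `i` learns the opinion of `j`), and `A i j` is its weight. -/
structure WeightedDigraph (n : ℕ) where
  Edge : Fin n → Fin n → Prop
  A : Matrix (Fin n) (Fin n) ℝ
  nonneg : ∀ i j, 0 ≤ A i j
  pos_iff : ∀ i j, 0 < A i j ↔ Edge j i
  diag_zero : ∀ i, A i i = 0

namespace WeightedDigraph

variable {n : ℕ}

open Classical in
/-- The set of incoming neighbours of the node `i`. -/
noncomputable def neighbors (G : WeightedDigraph n) (i : Fin n) : Finset (Fin n) :=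
  Finset.univ.filter fun j => G.Edge j i

/-- The graph Laplacian: `l_ii = ∑_{k ≠ i} a_ik` and `l_ij = -a_ij` for `j ≠ i`. -/
def laplacian (G : WeightedDigraph n) : Matrix (Fin n) (Fin n) ℝ :=
  Matrix.of fun i j => if i = j then ∑ k ∈ Finset.univ.erase i, G.A i k else -G.A i j

/-- The edge set `T` is a directed tree that spans all nodes: there is a root without parent, every
other node has exactly one parent, and every node is reached from the root by a directed path. -/
def IsDirectedSpanningTree (T : Fin n → Fin n → Prop) : Prop :=
  ∃ r : Fin n, (∀ u, ¬ T u r) ∧ (∀ v, v ≠ r → ∃! u, T u v) ∧ ∀ v, Relation.ReflTransGen T r v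

/-- Some subset of the edges of `G` forms a directed spanning tree. -/
def HasDirectedSpanningTree (G : WeightedDigraph n) : Prop :=
  ∃ T : Fin n → Fin n → Prop, (∀ u v, T u v → G.Edge u v) ∧ IsDirectedSpanningTree T

/-- `γ` is a nonnegative left eigenvector of the Laplacian for the eigenvalue `0`, with entries
summing to one. -/
def IsNormalizedLeftNullVector (G : WeightedDigraph n) (γ : Fin n → ℝ) : Prop :=
  (∀ i, 0 ≤ γ i) ∧ γ ᵥ* G.laplacian = 0 ∧ ∑ i, γ i = 1

end WeightedDigraph

/-- The assumption on the logic matrix: `1` is a semi-simple eigenvalue of multiplicity `p ≥ 1`, every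
other complex eigenvalue has real part less than one, and the diagonal is nonnegative. -/
structure IsLogicMatrix {d : ℕ} (C : Matrix (Fin d) (Fin d) ℝ) (p : ℕ) : Prop where
  one_le : 1 ≤ p
  algebraic_multiplicity : C.charpoly.rootMultiplicity 1 = p
  geometric_multiplicity :
    Module.finrank ℝ (Module.End.eigenspace (Matrix.toLin' C) (1 : ℝ)) = p
  re_lt_one : ∀ z : ℂ,
    Module.End.HasEigenvalue (Matrix.toLin' (C.map Complex.ofReal)) z → z ≠ 1 → z.re < 1
  diag_nonneg : ∀ k, 0 ≤ C k k

/-- `ζ` and `ξ` are right and left eigenvectors of `C` for the eigenvalue `1`, dual to each other. If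
`p` is the multiplicity of the semi-simple eigenvalue `1`, they are bases of the two eigenspaces. -/
structure IsDualEigenvectorFamily {d p : ℕ} (C : Matrix (Fin d) (Fin d) ℝ)
    (ζ ξ : Fin p → Fin d → ℝ) : Prop where
  right : ∀ r, C *ᵥ ζ r = ζ r
  left : ∀ r, ξ r ᵥ* C = ξ r
  dual : ∀ r s, ξ r ⬝ᵥ ζ s = if r = s then 1 else 0

section
attribute [local instance] Matrix.linftyOpNormedAddCommGroup

/-- The `∞`-norm of a matrix, that is, its maximal absolute row sum. -/
noncomputable def matrixInfNorm {d : ℕ} (C : Matrix (Fin d) (Fin d) ℝ) : ℝ := ‖C‖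

end

/-- `x` solves Model 1 without stubbornness for all times `t ≥ 0`; `x t i` is the opinion vector of
individual `i` at time `t` (the derivative at `t = 0` is one-sided). -/
def IsModel1Solution {n d : ℕ} (G : WeightedDigraph n) (C : Matrix (Fin d) (Fin d) ℝ)
    (x : ℝ → Fin n → Fin d → ℝ) : Prop :=
  ∀ t : ℝ, 0 ≤ t → ∀ i : Fin n,
    HasDerivWithinAt (fun s => x s i)
      ((∑ j ∈ G.neighbors i, G.A i j • (C *ᵥ (x t j - x t i))) + (C - 1) *ᵥ x t i)
      (Set.Ici 0) t

/-- Global exponential consensus: all differences of opinion vectors decay exponentially, with a rate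
and a constant that do not depend on the initial opinions. -/
def ReachesConsensusGloballyExponentially {n d : ℕ} (G : WeightedDigraph n)
    (C : Matrix (Fin d) (Fin d) ℝ) : Prop :=
  ∃ K α : ℝ, 0 < α ∧ ∀ x : ℝ → Fin n → Fin d → ℝ, IsModel1Solution G C x →
    ∀ t : ℝ, 0 ≤ t → ∀ i j : Fin n, ‖x t i - x t j‖ ≤ K * Real.exp (-α * t) * ‖x 0‖

/-- The final opinion vector `(∑ r, ζ_r ξ_rᵀ) ∑ j, γ_j x_j(0)`. -/
def finalOpinion {n d p : ℕ} (γ : Fin n → ℝ) (ζ ξ : Fin p → Fin d → ℝ)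
    (x₀ : Fin n → Fin d → ℝ) : Fin d → ℝ :=
  (∑ r, Matrix.vecMulVec (ζ r) (ξ r)) *ᵥ ∑ j, γ j • x₀ j

/-! Put `P = 1 - L` and `A = P ⊗ C`; the dynamics read `x' = (A - 1) x`. The bound on the diagonal
of `L` makes `P` row-stochastic, so with `‖C‖∞ = 1` the operator `A` is a contraction for the sup
norm, and no spectral analysis of `A` is needed.

For a contraction in finite dimension, `e^{t(A-1)}` converges exponentially to the projection onto
the fixed space of `A` (`IsFixedSpaceProjection.exists_exponential_bound`). On the complementary
subspace the sums `∑_{k<N} A^k v` stay bounded as `N` grows, so the series of `e^A` has enough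
cancellation there to make `e^{A-1}` a strict contraction.

It remains to find the fixed space. The positive diagonal of `C` yields `‖C - c‖ ≤ 1 - c` with `c >
0`, which forces a fixed point of `PC` to be fixed by `C` (`fixed_of_mul_fixed`), hence by `P`. Each
coordinate is then harmonic on the graph, and constant by the maximum principle if there is a root.
The explicit limit formula is a projection onto exactly this space.

Without a root, two nodes have disjoint sets of ancestors. These sets evolve independently, so they
can hold different equilibria forever. -/

/-! ### Fixed spaces of contractions. -/

section ContractionSemigroups

open NormedSpace

variable {V : Type*} [NormedAddCommGroup V] [NormedSpace ℝ V]

/-- The telescoping identity behind the boundedness of power sums on the range of `1 - A`. -/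
theorem sum_pow_apply_sub (A : V →L[ℝ] V) (u : V) (N : ℕ) :
    ∑ k ∈ Finset.range N, (A ^ k) (u - A u) = u - (A ^ N) u := by
  induction N with
  | zero => simp
  | succ N ih =>
    rw [Finset.sum_range_succ, ih, map_sub, pow_succ]
    simp

theorem norm_pow_apply_le {A : V →L[ℝ] V} (hA : ∀ x, ‖A x‖ ≤ ‖x‖) (k : ℕ) (x : V) :
    ‖(A ^ k) x‖ ≤ ‖x‖ := by
  induction k with
  | zero => simp
  | succ k ih =>
    rw [pow_succ']
    exact (hA _).trans ih

/-- If `P` and `C` are commuting contractions and `C` has a positive multiple of the identity as a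
convex component, then every fixed point of `P * C` is a fixed point of `C`. -/
theorem fixed_of_mul_fixed {P C : V →L[ℝ] V} (hPC : Commute P C) (hP : ∀ x, ‖P x‖ ≤ ‖x‖)
    {c : ℝ} (hc : 0 < c) (hc1 : c ≤ 1) (hC : ∀ x, ‖C x - c • x‖ ≤ (1 - c) * ‖x‖)
    {x : V} (hx : P (C x) = x) : C x = x := by
  have hC1 : ∀ x, ‖C x‖ ≤ ‖x‖ := fun x => by
    calc ‖C x‖ = ‖(C x - c • x) + c • x‖ := by rw [sub_add_cancel]
      _ ≤ (1 - c) * ‖x‖ + c * ‖x‖ := by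
        refine (norm_add_le _ _).trans (add_le_add (hC x) ?_)
        rw [norm_smul, Real.norm_of_nonneg hc.le]
      _ = ‖x‖ := by ring
  set v := x - C x with hv
  have hfix : (P * C) v = v := by
    have h : P (C (C x)) = C (P (C x)) := DFunLike.congr_fun hPC (C x)
    simp [hv, h, hx]
  have hfixm : ∀ m : ℕ, (P ^ m) ((C ^ m) v) = v := fun m => by
    have h : ((P * C) ^ m) v = v := by
      induction m with
      | zero => simp
      | succ m ih => rw [pow_succ, mul_apply_eq_comp, hfix, ih]
    rwa [hPC.mul_pow] at h
  have key : ∀ m : ℕ, m * ‖v‖ ≤ 2 * ‖x‖ := fun m => by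
    -- A norming functional at the last iterate: `f` is large there, and the positive multiple `c`
    -- of the identity in `C` carries this lower bound back to all earlier iterates.
    obtain ⟨f, hf, hfv⟩ := exists_dual_vector'' ℝ ((C ^ m) v)
    have hf1 : ∀ y, f y ≤ ‖y‖ := fun y =>
      (le_abs_self _).trans ((f.le_of_opNorm_le hf y).trans (by rw [one_mul]))
    have htop : ‖v‖ ≤ f ((C ^ m) v) := by
      rw [hfv]
      calc ‖v‖ = ‖(P ^ m) ((C ^ m) v)‖ := by rw [hfixm]
        _ ≤ ‖(C ^ m) v‖ := norm_pow_apply_le hP m _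
    have hdown : ∀ j k, j + k = m → ‖v‖ ≤ f ((C ^ k) v) := by
      intro j
      induction j with
      | zero => rintro k h; rw [zero_add] at h; rwa [h]
      | succ j ih =>
        intro k h
        have h1 := ih (k + 1) (by omega)
        have h2 : f ((C ^ (k + 1)) v)
            = c * f ((C ^ k) v) + f (C ((C ^ k) v) - c • (C ^ k) v) := by
          rw [f.map_sub (C _), f.map_smul, smul_eq_mul, add_sub_cancel, pow_succ']
          rfl
        have h3 : f (C ((C ^ k) v) - c • (C ^ k) v) ≤ (1 - c) * ‖v‖ :=
          (hf1 _).trans ((hC _).trans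
            (mul_le_mul_of_nonneg_left (norm_pow_apply_le hC1 k v) (by linarith)))
        -- The left side of `h2` is at least `‖v‖` and the remainder is at most `(1 - c) * ‖v‖`, so
        -- the term with factor `c` supplies the rest.
        have h4 : c * ‖v‖ ≤ c * f ((C ^ k) v) := by linarith
        exact le_of_mul_le_mul_left h4 hc
    -- Since `v = x - C x`, the sum of the iterates telescopes and stays bounded, although each of
    -- its `m` terms contributes at least `‖v‖` under `f`.
    calc (m : ℝ) * ‖v‖ = ∑ k ∈ Finset.range m, ‖v‖ := by simp
      _ ≤ ∑ k ∈ Finset.range m, f ((C ^ k) v) := Finset.sum_le_sum fun k hk =>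
        hdown (m - k) k (by have := Finset.mem_range.1 hk; omega)
      _ = f (x - (C ^ m) x) := by rw [← map_sum, sum_pow_apply_sub]
      _ ≤ ‖x‖ + ‖(C ^ m) x‖ := (hf1 _).trans (norm_sub_le _ _)
      _ ≤ 2 * ‖x‖ := by linarith [norm_pow_apply_le hC1 m x]
  have hv0 : ‖v‖ = 0 := by
    by_contra hne
    have hpos : 0 < ‖v‖ := lt_of_le_of_ne (norm_nonneg _) (Ne.symm hne)
    obtain ⟨m, hm⟩ := exists_nat_gt (2 * ‖x‖ / ‖v‖)
    rw [div_lt_iff₀ hpos] at hm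
    linarith [key m]
  exact (sub_eq_zero.1 (norm_eq_zero.1 hv0)).symm

/-- `Q` is a projection onto the fixed space of `A` that commutes with `A`. -/
structure IsFixedSpaceProjection (A Q : V →L[ℝ] V) : Prop where
  apply_left : ∀ x, A (Q x) = Q x
  apply_right : ∀ x, Q (A x) = Q x
  idem : ∀ x, Q (Q x) = Q x
  eq_zero : ∀ x, A x = x → Q x = 0 → x = 0

/-- A fixed vector `u - A u` has power sums `m (u - A u) = u - A^m u`, bounded in `m`, so it
vanishes. Thus kernel and range of `1 - A` are disjoint, and complementary by rank-nullity; `Q`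
projects onto the kernel along the range. -/
theorem exists_isFixedSpaceProjection [FiniteDimensional ℝ V] {A : V →L[ℝ] V}
    (hA : ∀ x, ‖A x‖ ≤ ‖x‖) : ∃ Q : V →L[ℝ] V, IsFixedSpaceProjection A Q := by
  set F : V →ₗ[ℝ] V := ((1 - A : V →L[ℝ] V) : V →ₗ[ℝ] V) with hF
  have hFx : ∀ x, F x = x - A x := fun x => rfl
  have hdisj : Disjoint (LinearMap.ker F) (LinearMap.range F) := by
    rw [Submodule.disjoint_def]
    rintro v hv ⟨u, rfl⟩
    have hAv : A (F u) = F u := by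
      rw [LinearMap.mem_ker, hFx, sub_eq_zero] at hv
      exact hv.symm
    have hpow : ∀ k : ℕ, (A ^ k) (F u) = F u := fun k => by
      induction k with
      | zero => simp
      | succ k ih => rw [pow_succ, mul_apply_eq_comp, hAv, ih]
    have key : ∀ m : ℕ, m * ‖F u‖ ≤ 2 * ‖u‖ := fun m => by
      have h := sum_pow_apply_sub A u m
      rw [← hFx] at h
      simp only [hpow, Finset.sum_const, Finset.card_range] at h
      calc (m : ℝ) * ‖F u‖ = ‖m • F u‖ := by rw [← Nat.cast_smul_eq_nsmul ℝ, norm_smul]; simp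
        _ ≤ ‖u‖ + ‖(A ^ m) u‖ := by rw [h]; exact norm_sub_le _ _
        _ ≤ 2 * ‖u‖ := by linarith [norm_pow_apply_le hA m u]
    by_contra hne
    have hpos : 0 < ‖F u‖ := norm_pos_iff.2 hne
    obtain ⟨m, hm⟩ := exists_nat_gt (2 * ‖u‖ / ‖F u‖)
    rw [div_lt_iff₀ hpos] at hm
    linarith [key m]
  have hcompl : IsCompl (LinearMap.ker F) (LinearMap.range F) := by
    refine (Submodule.isCompl_iff_disjoint _ _ ?_).2 hdisj
    rw [add_comm, F.finrank_range_add_finrank_ker]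
  set Q := Submodule.projection _ _ hcompl with hQ
  have hmem : ∀ x, A (Q x) = Q x := fun x => by
    have h : Q x ∈ LinearMap.ker F := Submodule.projection_apply_mem hcompl x
    rw [LinearMap.mem_ker, hFx, sub_eq_zero] at h
    exact h.symm
  have hfix : ∀ x, A x = x → Q x = x := fun x hx =>
    (Submodule.projection_eq_self_iff hcompl x).2 (by rw [LinearMap.mem_ker, hFx, hx, sub_self])
  refine ⟨LinearMap.toContinuousLinearMap Q, hmem, fun x => ?_, fun x => hfix _ (hmem x),
    fun x hx h => ?_⟩
  · have h : Q (F x) = 0 := (Submodule.projection_apply_eq_zero_iff hcompl).2 ⟨x, rfl⟩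
    rw [hFx, map_sub, sub_eq_zero] at h
    exact h.symm
  · rw [← hfix x hx]; exact h

/-! ### Exponentials of contractions and their decay. -/

theorem hasSum_exp_apply [CompleteSpace V] (A : V →L[ℝ] V) (x : V) :
    HasSum (fun k : ℕ => ((k.factorial : ℝ)⁻¹) • (A ^ k) x) (exp A x) := by
  have h := (exp_series_hasSum_exp' (𝕂 := ℝ) A).mapL (ContinuousLinearMap.apply ℝ V x)
  simpa using h

theorem hasSum_pow_div_factorial (s : ℝ) :
    HasSum (fun k : ℕ => s ^ k / k.factorial) (Real.exp s) := by
  rw [Real.exp_eq_exp_ℝ]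
  exact expSeries_div_hasSum_exp s

theorem exp_smul_apply_of_apply_eq_zero [CompleteSpace V] {M : V →L[ℝ] V} {x : V}
    (hx : M x = 0) (t : ℝ) : exp (t • M) x = x := by
  refine (hasSum_exp_apply (t • M) x).unique ?_
  convert hasSum_ite_eq (0 : ℕ) x using 2 with k
  split_ifs with hk
  · simp [hk]
  · obtain ⟨j, rfl⟩ := Nat.exists_eq_succ_of_ne_zero hk
    rw [Nat.succ_eq_add_one, pow_succ, mul_apply_eq_comp, smul_apply, hx, smul_zero, map_zero,
      smul_zero]

theorem exp_smul_sub_one_apply [CompleteSpace V] (A : V →L[ℝ] V) (t : ℝ) (x : V) :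
    exp (t • (A - 1)) x = Real.exp (-t) • exp (t • A) x := by
  let : NormedAlgebra ℚ (V →L[ℝ] V) := NormedAlgebra.restrictScalars ℚ ℝ _
  have h : t • (A - 1) = algebraMap ℝ (V →L[ℝ] V) (-t) + t • A := by
    rw [Algebra.algebraMap_eq_smul_one, smul_sub, neg_smul]; abel
  rw [h, exp_add_of_commute (Algebra.commutes _ _), ← algebraMap_exp_comm,
    Algebra.algebraMap_eq_smul_one, Real.exp_eq_exp_ℝ]
  rfl

/-- The exponential series bounds `e^{tA}` by `e^t`, which the scalar factor `e^{-t}` cancels. -/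
theorem norm_exp_smul_sub_one_apply_le [CompleteSpace V] {A : V →L[ℝ] V}
    (hA : ∀ x, ‖A x‖ ≤ ‖x‖) {t : ℝ} (ht : 0 ≤ t) (x : V) :
    ‖exp (t • (A - 1)) x‖ ≤ ‖x‖ := by
  have h : ‖exp (t • A) x‖ ≤ Real.exp t * ‖x‖ := by
    rw [← (hasSum_exp_apply (t • A) x).tsum_eq]
    refine tsum_of_norm_bounded ((hasSum_pow_div_factorial t).mul_right ‖x‖) fun k => ?_
    rw [smul_pow, smul_apply, norm_smul, norm_smul, div_eq_inv_mul, mul_assoc,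
      Real.norm_of_nonneg (by positivity), Real.norm_of_nonneg (by positivity)]
    gcongr
    exact norm_pow_apply_le hA k x
  rw [exp_smul_sub_one_apply, norm_smul, Real.norm_of_nonneg (Real.exp_pos _).le]
  calc Real.exp (-t) * ‖exp (t • A) x‖ ≤ Real.exp (-t) * (Real.exp t * ‖x‖) := by gcongr
    _ = ‖x‖ := by rw [← mul_assoc, ← Real.exp_add]; simp

/-- On the kernel of a fixed space projection, the power sums of `A` are bounded. -/
theorem IsFixedSpaceProjection.exists_sum_pow_bound [FiniteDimensional ℝ V] {A Q : V →L[ℝ] V}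
    (hA : ∀ x, ‖A x‖ ≤ ‖x‖) (hQ : IsFixedSpaceProjection A Q) :
    ∃ κ : ℝ, ∀ v, Q v = 0 → ∀ N : ℕ, ‖∑ k ∈ Finset.range N, (A ^ k) v‖ ≤ κ * ‖v‖ := by
  -- Adding `Q` makes `1 - A` invertible, and `Q R = Q` shows that the inverse preserves `ker Q`. So
  -- each `v` there is `u - A u` with `‖u‖` controlled by `‖v‖`, and its power sums telescope.
  set R : V →ₗ[ℝ] V := ((1 - A + Q : V →L[ℝ] V) : V →ₗ[ℝ] V) with hR
  have hRx : ∀ x, R x = x - A x + Q x := fun x => rfl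
  have hQR : ∀ x, Q (R x) = Q x := fun x => by
    rw [hRx, map_add, map_sub, hQ.apply_right, hQ.idem, sub_self, zero_add]
  have hinj : Function.Injective R := by
    rw [injective_iff_map_eq_zero]
    intro x hx
    have hQx : Q x = 0 := by rw [← hQR, hx, map_zero]
    refine hQ.eq_zero x ?_ hQx
    rw [hRx, hQx, add_zero, sub_eq_zero] at hx
    exact hx.symm
  set e := LinearEquiv.ofInjectiveEndo R hinj
  set U : V →L[ℝ] V := LinearMap.toContinuousLinearMap (e.symm : V →ₗ[ℝ] V)
  have hU : ∀ v, R (U v) = v := fun v => e.apply_symm_apply v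
  refine ⟨2 * ‖U‖, fun v hv N => ?_⟩
  have hQU : Q (U v) = 0 := by rw [← hQR, hU, hv]
  have hvU : v = U v - A (U v) := by
    have h := hU v
    rw [hRx, hQU, add_zero] at h
    exact h.symm
  have hsum : ∑ k ∈ Finset.range N, (A ^ k) v = U v - (A ^ N) (U v) := by
    rw [← sum_pow_apply_sub, ← hvU]
  rw [hsum]
  linarith [norm_sub_le (U v) ((A ^ N) (U v)), norm_pow_apply_le hA N (U v), U.le_opNorm v]

/-- Split off the weight `1 / N!` from each of the first `N` coefficients of the exponential series.
The split part is a multiple of a power sum, of norm at most `κ / N! * ‖v‖` instead of the trivial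
`N / N! * ‖v‖`; this is a gain once `N > κ`. -/
theorem IsFixedSpaceProjection.exists_norm_exp_le [FiniteDimensional ℝ V] {A Q : V →L[ℝ] V}
    (hA : ∀ x, ‖A x‖ ≤ ‖x‖) (hQ : IsFixedSpaceProjection A Q) :
    ∃ q : ℝ, 0 < q ∧ q < 1 ∧ ∀ v, Q v = 0 → ‖exp (A - 1) v‖ ≤ q * ‖v‖ := by
  have : CompleteSpace V := FiniteDimensional.complete ℝ V
  obtain ⟨κ, hκ⟩ := hQ.exists_sum_pow_bound hA
  obtain ⟨N, hN⟩ := exists_nat_gt κ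
  set b : ℝ := ((N.factorial : ℝ))⁻¹ with hb
  have hb0 : 0 < b := by positivity
  set β : ℕ → ℝ := fun k => if k < N then b else 0 with hβ
  have hfin : ∀ k ∉ Finset.range N, β k = 0 := fun k hk => by
    simp only [Finset.mem_range] at hk; simp [hβ, hk]
  have hβN : ∀ k ∈ Finset.range N, β k = b := fun k hk => by
    simp only [Finset.mem_range] at hk; simp [hβ, hk]
  have hβle : ∀ k : ℕ, β k ≤ (k.factorial : ℝ)⁻¹ := fun k => by
    simp only [hβ]
    split_ifs with h
    · rw [hb]; gcongr
    · positivity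
  have hβsum : HasSum β (N * b) := by
    have h : HasSum β (∑ k ∈ Finset.range N, β k) := hasSum_sum_of_ne_finset_zero hfin
    rwa [Finset.sum_congr rfl hβN, Finset.sum_const, Finset.card_range, nsmul_eq_mul] at h
  have hbound : ∀ v, Q v = 0 → ‖exp A v‖ ≤ (Real.exp 1 - (N - κ) * b) * ‖v‖ := fun v hv => by
    have h1 : HasSum (fun k => β k • (A ^ k) v) (b • ∑ k ∈ Finset.range N, (A ^ k) v) := by
      have h : HasSum (fun k => β k • (A ^ k) v) (∑ k ∈ Finset.range N, β k • (A ^ k) v) :=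
        hasSum_sum_of_ne_finset_zero fun k hk => by rw [hfin k hk, zero_smul]
      rwa [Finset.sum_congr rfl fun k hk => by rw [hβN k hk], ← Finset.smul_sum] at h
    have h2 := (hasSum_exp_apply A v).sub h1
    have h3 := ((hasSum_pow_div_factorial 1).sub hβsum).mul_right ‖v‖
    have h4 : ‖exp A v - b • ∑ k ∈ Finset.range N, (A ^ k) v‖
        ≤ (Real.exp 1 - N * b) * ‖v‖ := by
      rw [← h2.tsum_eq]
      refine tsum_of_norm_bounded h3 fun k => ?_
      rw [← sub_smul, norm_smul, Real.norm_of_nonneg (sub_nonneg.2 (hβle k)), one_pow, one_div]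
      exact mul_le_mul_of_nonneg_left (norm_pow_apply_le hA k v) (sub_nonneg.2 (hβle k))
    have h5 : ‖b • ∑ k ∈ Finset.range N, (A ^ k) v‖ ≤ b * (κ * ‖v‖) := by
      rw [norm_smul, Real.norm_of_nonneg hb0.le]
      exact mul_le_mul_of_nonneg_left (hκ v hv N) hb0.le
    have h6 := norm_le_norm_sub_add (exp A v) (b • ∑ k ∈ Finset.range N, (A ^ k) v)
    calc _ ≤ _ := h6
      _ ≤ (Real.exp 1 - N * b) * ‖v‖ + b * (κ * ‖v‖) := add_le_add h4 h5
      _ = _ := by ring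
  -- The maximum with `1 / 2` only keeps `q` positive, so that its logarithm can serve as a rate.
  refine ⟨max (1 / 2) (Real.exp (-1) * (Real.exp 1 - (N - κ) * b)), by positivity,
    max_lt (by norm_num) ?_, fun v hv => ?_⟩
  · have h : Real.exp (-1) * Real.exp 1 = 1 := by rw [← Real.exp_add]; simp
    have h' : 0 < Real.exp (-1) * ((N - κ) * b) :=
      mul_pos (Real.exp_pos _) (mul_pos (sub_pos.2 hN) hb0)
    rw [mul_sub, h]
    linarith
  · have h := exp_smul_sub_one_apply A 1 v
    rw [one_smul, one_smul] at h
    rw [h, norm_smul, Real.norm_of_nonneg (Real.exp_pos _).le]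
    calc Real.exp (-1) * ‖exp A v‖
        ≤ Real.exp (-1) * ((Real.exp 1 - (N - κ) * b) * ‖v‖) := by gcongr; exact hbound v hv
      _ = (Real.exp (-1) * (Real.exp 1 - (N - κ) * b)) * ‖v‖ := by ring
      _ ≤ _ := by gcongr; exact le_max_right _ _

/-- The semigroup generated by `A - 1`, for a contraction `A`, converges exponentially to the
projection onto the fixed space of `A`. -/
theorem IsFixedSpaceProjection.exists_exponential_bound [FiniteDimensional ℝ V]
    {A Q : V →L[ℝ] V} (hA : ∀ x, ‖A x‖ ≤ ‖x‖) (hQ : IsFixedSpaceProjection A Q) :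
    ∃ K α : ℝ, 0 < α ∧ ∀ (x : V) (t : ℝ), 0 ≤ t →
      ‖exp (t • (A - 1)) x - Q x‖ ≤ K * Real.exp (-α * t) * ‖x‖ := by
  have : CompleteSpace V := FiniteDimensional.complete ℝ V
  let : NormedAlgebra ℚ (V →L[ℝ] V) := NormedAlgebra.restrictScalars ℚ ℝ _
  obtain ⟨q, hq0, hq1, hq⟩ := hQ.exists_norm_exp_le hA
  have hcomm : Commute Q (A - 1) := by
    refine Commute.sub_right ?_ (Commute.one_right _)
    ext x
    exact (hQ.apply_right x).trans (hQ.apply_left x).symm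
  have hQexp : ∀ x, Q (exp (A - 1) x) = exp (A - 1) (Q x) :=
    fun x => DFunLike.congr_fun hcomm.exp_right x
  have hpow : ∀ (m : ℕ) v, Q v = 0 →
      Q ((exp (A - 1) ^ m) v) = 0 ∧ ‖(exp (A - 1) ^ m) v‖ ≤ q ^ m * ‖v‖ := by
    intro m v hv
    induction m with
    | zero => simp [hv]
    | succ m ih =>
      rw [pow_succ', mul_apply_eq_comp]
      refine ⟨by rw [hQexp, ih.1, map_zero], (hq _ ih.1).trans ?_⟩
      rw [pow_succ', mul_assoc]
      exact mul_le_mul_of_nonneg_left ih.2 hq0.le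
  have hfix : ∀ (t : ℝ) x, exp (t • (A - 1)) (Q x) = Q x := fun t x =>
    exp_smul_apply_of_apply_eq_zero (by simp [hQ.apply_left]) t
  -- The factor `q⁻¹` pays for replacing `t` by its integer part, and `1 + ‖Q‖` bounds `1 - Q`.
  refine ⟨q⁻¹ * (1 + ‖Q‖), -Real.log q, neg_pos.2 (Real.log_neg hq0 hq1), fun x t ht => ?_⟩
  set v := x - Q x with hv
  have hQv : Q v = 0 := by rw [hv, map_sub, hQ.idem, sub_self]
  have hxv : exp (t • (A - 1)) x - Q x = exp (t • (A - 1)) v := by rw [hv, map_sub, hfix]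
  set m := ⌊t⌋₊
  have hmt : (m : ℝ) ≤ t := Nat.floor_le ht
  have htm : t < m + 1 := Nat.lt_floor_add_one t
  have hsplit : exp (t • (A - 1)) = exp ((t - m) • (A - 1)) * exp (A - 1) ^ m := by
    rw [← exp_nsmul, ← exp_add_of_commute]
    · rw [← Nat.cast_smul_eq_nsmul ℝ, ← add_smul, sub_add_cancel]
    · exact (Commute.refl _).smul_left _ |>.smul_right _
  have hqm : q ^ m ≤ q⁻¹ * Real.exp (- -Real.log q * t) := by
    rw [neg_neg, Real.exp_mul, Real.exp_log hq0, ← Real.rpow_natCast, ← Real.rpow_neg_one,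
      ← Real.rpow_add hq0]
    exact Real.rpow_le_rpow_of_exponent_ge hq0 hq1.le (by linarith)
  have hvx : ‖v‖ ≤ (1 + ‖Q‖) * ‖x‖ := by
    linarith [norm_sub_le x (Q x), Q.le_opNorm x]
  rw [hxv, hsplit, mul_apply_eq_comp]
  calc _ ≤ ‖(exp (A - 1) ^ m) v‖ := norm_exp_smul_sub_one_apply_le hA (sub_nonneg.2 hmt) _
    _ ≤ q ^ m * ‖v‖ := (hpow m v hQv).2
    _ ≤ (q⁻¹ * Real.exp (- -Real.log q * t)) * ((1 + ‖Q‖) * ‖x‖) := by gcongr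
    _ = _ := by ring

/-! ### Linear differential equations. -/

/-- Closed subspaces that are invariant under `M` are invariant under `exp M`. -/
theorem exp_apply_mem [CompleteSpace V] {M : V →L[ℝ] V} {W : Submodule ℝ V}
    (hW : IsClosed (W : Set V)) (hM : ∀ x ∈ W, M x ∈ W) {x : V} (hx : x ∈ W) : exp M x ∈ W := by
  refine hW.mem_of_tendsto (hasSum_exp_apply M x) (Filter.Eventually.of_forall fun s =>
    W.sum_mem fun k _ => W.smul_mem _ ?_)
  clear * - hM hx
  induction k with
  | zero => exact hx
  | succ k ih => rw [pow_succ']; exact hM _ ih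

/-- Solutions of a linear differential equation are given by the exponential. -/
theorem eq_exp_smul_apply [CompleteSpace V] {M : V →L[ℝ] V} {x : ℝ → V}
    (hx : ∀ t, 0 ≤ t → HasDerivWithinAt x (M (x t)) (Set.Ici 0) t) {t : ℝ} (ht : 0 ≤ t) :
    x t = exp (t • M) (x 0) := by
  let : NormedAlgebra ℚ (V →L[ℝ] V) := NormedAlgebra.restrictScalars ℚ ℝ _
  -- Integrating factor: `e^{-rM} x(r)` has derivative zero.
  have hy : ∀ s, 0 ≤ s → HasDerivWithinAt (fun r => exp (r • -M) (x r)) 0 (Set.Ici 0) s :=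
    fun s hs => by
      have h := ((hasDerivAt_exp_smul_const (-M) s).hasDerivWithinAt (s := Set.Ici 0)).clm_apply
        (hx s hs)
      convert h using 1
      simp
  have hconst := constant_of_has_deriv_right_zero (a := 0) (b := t)
    (fun s hs => ((hy s hs.1).continuousWithinAt).mono Set.Icc_subset_Ici_self)
    (fun s hs => (hy s hs.1).mono (Set.Ici_subset_Ici.2 hs.1)) t (Set.right_mem_Icc.2 ht)
  simp only [zero_smul, exp_zero, one_apply_eq_self] at hconst
  rw [← hconst, ← mul_apply_eq_comp, ← exp_add_of_commute]
  · simp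
  · exact ((Commute.refl M).neg_right.smul_left _).smul_right _

theorem hasDerivAt_exp_smul_apply [CompleteSpace V] (M : V →L[ℝ] V) (x : V) (t : ℝ) :
    HasDerivAt (fun s : ℝ => exp (s • M) x) (M (exp (t • M) x)) t := by
  simpa using (hasDerivAt_exp_smul_const' M t).clm_apply (hasDerivAt_const t x)

end ContractionSemigroups

/-! ### The Laplacian and the row-stochastic matrix `1 - L`. -/

namespace WeightedDigraph

variable {n : ℕ} (G : WeightedDigraph n)

theorem eq_zero_of_not_edge {G : WeightedDigraph n} {i j : Fin n} (h : ¬ G.Edge j i) :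
    G.A i j = 0 :=
  le_antisymm (not_lt.1 fun h' => h ((G.pos_iff i j).1 h')) (G.nonneg i j)

theorem laplacian_apply (i j : Fin n) :
    G.laplacian i j = (if i = j then ∑ k, G.A i k else 0) - G.A i j := by
  by_cases h : i = j
  · subst h
    simp only [laplacian, Matrix.of_apply, if_true]
    rw [← Finset.add_sum_erase _ _ (Finset.mem_univ i)]
    ring
  · simp [laplacian, h]

theorem sum_laplacian_smul {E : Type*} [AddCommGroup E] [Module ℝ E] (x : Fin n → E)
    (i : Fin n) : ∑ j, G.laplacian i j • x j = ∑ j, G.A i j • (x i - x j) := by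
  simp only [laplacian_apply, sub_smul, ite_smul, zero_smul, Finset.sum_sub_distrib,
    Finset.sum_ite_eq, Finset.mem_univ, if_true, smul_sub, Finset.sum_smul]

/-- The matrix `1 - L`, which is row-stochastic if the diagonal of `L` is at most `1`. -/
def transition : Matrix (Fin n) (Fin n) ℝ := 1 - G.laplacian

theorem transition_of_ne {i j : Fin n} (h : i ≠ j) : G.transition i j = G.A i j := by
  simp [transition, laplacian_apply, h]

theorem sum_transition_smul {E : Type*} [AddCommGroup E] [Module ℝ E] (x : Fin n → E)
    (i : Fin n) : ∑ j, G.transition i j • x j = x i - ∑ j, G.A i j • (x i - x j) := by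
  rw [← sum_laplacian_smul]
  simp [transition, sub_smul, Matrix.one_apply]

theorem transition_nonneg (hL : ∀ i, G.laplacian i i ≤ 1) (i j : Fin n) :
    0 ≤ G.transition i j := by
  by_cases h : i = j
  · subst h; simpa [transition] using hL i
  · rw [G.transition_of_ne h]; exact G.nonneg i j

theorem sum_transition (i : Fin n) : ∑ j, G.transition i j = 1 := by
  simpa using G.sum_transition_smul (fun _ => (1 : ℝ)) i

/-! ### Roots, spanning trees and harmonic functions. -/

/-- `r` is a root if every node is reached from it. -/
def IsRoot (r : Fin n) : Prop := ∀ v, Relation.ReflTransGen G.Edge r v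

/-- Length-`k` walks from `r`. -/
def WalkOfLength (r : Fin n) : ℕ → Fin n → Prop
  | 0, v => v = r
  | k + 1, v => ∃ u, WalkOfLength r k u ∧ G.Edge u v

theorem exists_walkOfLength {G : WeightedDigraph n} {r v : Fin n}
    (h : Relation.ReflTransGen G.Edge r v) : ∃ k, G.WalkOfLength r k v := by
  induction h with
  | refl => exact ⟨0, rfl⟩
  | tail _ h ih => exact ih.elim fun k hk => ⟨k + 1, _, hk, h⟩

-- A breadth-first tree: the parent of a node is its predecessor on a shortest walk from the root,
-- so the distance drops at each step towards the root.
open Classical in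
theorem hasDirectedSpanningTree_iff : G.HasDirectedSpanningTree ↔ ∃ r, G.IsRoot r := by
  constructor
  · rintro ⟨T, hT, r, -, -, hr⟩
    exact ⟨r, fun v => Relation.ReflTransGen.mono hT _ _ (hr v)⟩
  · rintro ⟨r, hr⟩
    have hex : ∀ v, ∃ k, G.WalkOfLength r k v := fun v => exists_walkOfLength (hr v)
    set dist : Fin n → ℕ := fun v => Nat.find (hex v) with hdist
    have hpar : ∀ v, ∃ u, v ≠ r → G.Edge u v ∧ dist u < dist v := fun v => by
      by_cases hv : v = r
      · exact ⟨r, fun h => absurd hv h⟩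
      · have hspec : G.WalkOfLength r (dist v) v := Nat.find_spec (hex v)
        rcases hk : dist v with _ | k
        · rw [hk] at hspec
          exact absurd hspec hv
        · rw [hk] at hspec
          obtain ⟨u, hu, huv⟩ := hspec
          have hle : dist u ≤ k := Nat.find_min' (hex u) hu
          exact ⟨u, fun _ => ⟨huv, by omega⟩⟩
    choose par hpar using hpar
    refine ⟨fun u v => v ≠ r ∧ u = par v, ?_, r, fun u h => h.1 rfl, fun v hv => ?_, fun v => ?_⟩
    · rintro u v ⟨hv, rfl⟩
      exact (hpar v hv).1
    · exact ⟨par v, ⟨hv, rfl⟩, fun u hu => hu.2⟩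
    · induction h : dist v using Nat.strong_induction_on generalizing v with
      | _ k ih =>
        by_cases hv : v = r
        · rw [hv]
        · exact (ih _ (h ▸ (hpar v hv).2) _ rfl).tail ⟨hv, rfl⟩

/-- Maximum principle: at a maximal node all terms of the harmonic sum are nonnegative, so every
in-neighbour is maximal too. Going back along a path carries the maximum to the root. -/
theorem IsRoot.le_of_harmonic {G : WeightedDigraph n} {r : Fin n} (hr : G.IsRoot r)
    {v : Fin n → ℝ} (hv : ∀ i, ∑ j, G.A i j * (v i - v j) = 0) (i : Fin n) : v i ≤ v r := by
  have : Nonempty (Fin n) := ⟨r⟩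
  obtain ⟨m, hm⟩ := Finite.exists_max v
  have hstep : ∀ u w, G.Edge u w → v w = v m → v u = v m := fun u w huw hw => by
    have hnn : ∀ j ∈ Finset.univ, 0 ≤ G.A w j * (v w - v j) := fun j _ =>
      mul_nonneg (G.nonneg _ _) (by rw [hw]; linarith [hm j])
    have h := (Finset.sum_eq_zero_iff_of_nonneg hnn).1 (hv w) u (Finset.mem_univ _)
    rcases mul_eq_zero.1 h with h | h
    · exact absurd h ((G.pos_iff w u).2 huw).ne'
    · linarith
  have hrm : v r = v m :=
    Relation.ReflTransGen.head_induction_on (motive := fun a _ => v a = v m) (hr m) rfl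
      fun hab _ ih => hstep _ _ hab ih
  rw [hrm]
  exact hm i

/-- Harmonic functions on a graph with a root are constant. -/
theorem IsRoot.eq_of_harmonic {G : WeightedDigraph n} {r : Fin n} (hr : G.IsRoot r)
    {v : Fin n → ℝ} (hv : ∀ i, ∑ j, G.A i j * (v i - v j) = 0) (i : Fin n) : v i = v r := by
  refine le_antisymm (hr.le_of_harmonic hv i) ?_
  have h := hr.le_of_harmonic (v := -v) (fun i => ?_) i
  · simpa using h
  · rw [← neg_eq_zero, ← Finset.sum_neg_distrib, ← hv i]
    exact Finset.sum_congr rfl fun j _ => by simp only [Pi.neg_apply]; ring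

/-- The nodes from which `i` is reached. -/
def ancestors (i : Fin n) : Set (Fin n) := {j | Relation.ReflTransGen G.Edge j i}

/-- If any two nodes had a common ancestor, the ancestor relation would be directed, and finiteness
would give a common ancestor of all nodes, that is, a root. -/
theorem exists_disjoint_ancestors (hn : 0 < n) (h : ¬ ∃ r, G.IsRoot r) :
    ∃ i j, Disjoint (G.ancestors i) (G.ancestors j) := by
  by_contra! hcon
  have : Nonempty (Fin n) := ⟨⟨0, hn⟩⟩
  let R : Fin n → Fin n → Prop := fun a b => Relation.ReflTransGen G.Edge b a
  have : IsTrans (Fin n) R := ⟨fun _ _ _ hab hbc => hbc.trans hab⟩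
  have hdir : Directed R (id : Fin n → Fin n) := fun i j => by
    obtain ⟨k, hi, hj⟩ := Set.not_disjoint_iff.1 (hcon i j)
    exact ⟨k, hi, hj⟩
  obtain ⟨r, hr⟩ := hdir.finite_le id
  exact h ⟨r, hr⟩

/-! ### The normalized left null vector. -/

theorem sum_mul_transition (γ : Fin n → ℝ) (j : Fin n) :
    ∑ i, γ i * G.transition i j = γ j - (γ ᵥ* G.laplacian) j := by
  change (γ ᵥ* G.transition) j = _
  rw [transition, Matrix.vecMul_sub, Matrix.vecMul_one]
  rfl

/-- `L` kills constants, so it is singular and has some left null vector `w`. By the triangle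
inequality `|w| ≤ |w| P` entrywise; both sides have the same total because `P` has row sums one, so
they agree and `|w|` can be normalized. -/
theorem exists_isNormalizedLeftNullVector (hn : 0 < n) (hL : ∀ i, G.laplacian i i ≤ 1) :
    ∃ γ, G.IsNormalizedLeftNullVector γ := by
  have : Nonempty (Fin n) := ⟨⟨0, hn⟩⟩
  have hdet : G.laplacian.det = 0 := by
    refine Matrix.exists_mulVec_eq_zero_iff.1 ⟨fun _ => 1, ?_, ?_⟩
    · exact fun h => one_ne_zero (congrFun h ⟨0, hn⟩)
    · ext i
      simpa [Matrix.mulVec, dotProduct] using G.sum_laplacian_smul (fun _ => (1 : ℝ)) i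
  obtain ⟨w, hw, hwL⟩ := Matrix.exists_vecMul_eq_zero_iff.2 hdet
  have hle : ∀ j ∈ Finset.univ, |w j| ≤ ∑ i, |w i| * G.transition i j := fun j _ => by
    have h : w j = ∑ i, w i * G.transition i j := by
      rw [sum_mul_transition, hwL, Pi.zero_apply, sub_zero]
    calc |w j| = |∑ i, w i * G.transition i j| := congrArg _ h
      _ ≤ ∑ i, |w i * G.transition i j| := Finset.abs_sum_le_sum_abs _ _
      _ = _ := Finset.sum_congr rfl fun i _ => by
        rw [abs_mul, abs_of_nonneg (G.transition_nonneg hL i j)]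
  have heq : ∀ j ∈ Finset.univ, |w j| = ∑ i, |w i| * G.transition i j := by
    refine (Finset.sum_eq_sum_iff_of_le hle).1 ?_
    rw [Finset.sum_comm]
    exact Finset.sum_congr rfl fun i _ => by rw [← Finset.mul_sum, sum_transition, mul_one]
  have hpos : 0 < ∑ i, |w i| := by
    obtain ⟨i, hi⟩ := Function.ne_iff.1 hw
    exact Finset.sum_pos' (fun _ _ => abs_nonneg _) ⟨i, Finset.mem_univ _, abs_pos.2 hi⟩
  refine ⟨(∑ i, |w i|)⁻¹ • fun i => |w i|, fun i => ?_, ?_, ?_⟩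
  · exact mul_nonneg (inv_nonneg.2 hpos.le) (abs_nonneg _)
  · rw [Matrix.smul_vecMul]
    convert smul_zero _
    ext j
    have h := G.sum_mul_transition (fun i => |w i|) j
    rw [← heq j (Finset.mem_univ _)] at h
    rw [Pi.zero_apply]
    linarith
  · simp only [Pi.smul_apply, smul_eq_mul, ← Finset.mul_sum]
    exact inv_mul_cancel₀ hpos.ne'

theorem IsRoot.eq_of_isNormalizedLeftNullVector {G : WeightedDigraph n} {r : Fin n}
    (hr : G.IsRoot r) {γ γ' : Fin n → ℝ} (hγ : G.IsNormalizedLeftNullVector γ)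
    (hγ' : G.IsNormalizedLeftNullVector γ') : γ' = γ := by
  obtain ⟨-, hγL, hγ1⟩ := hγ
  obtain ⟨-, hγL', hγ1'⟩ := hγ'
  -- This rank-one correction makes the Laplacian invertible: pairing `M v = 0` with `γ` gives `γ ⬝ᵥ
  -- v = 0`, so `v` is harmonic, hence constant, hence zero. Both null vectors have the same image
  -- under `M`.
  set M := G.laplacian + Matrix.vecMulVec 1 γ with hM
  have hdet : M.det ≠ 0 := by
    intro h
    obtain ⟨v, hv, hMv⟩ := Matrix.exists_mulVec_eq_zero_iff.2 h
    rw [hM, Matrix.add_mulVec, Matrix.vecMulVec_mulVec] at hMv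
    have hγv : γ ⬝ᵥ v = 0 := by
      have h := congrArg (fun u => γ ⬝ᵥ u) hMv
      simp only [dotProduct_add, Matrix.dotProduct_mulVec, hγL, zero_dotProduct, dotProduct_zero,
        dotProduct_smul, dotProduct_one, hγ1] at h
      simpa using h
    rw [hγv] at hMv
    simp only [MulOpposite.op_zero, zero_smul, add_zero] at hMv
    have hconst : ∀ i, v i = v r := hr.eq_of_harmonic fun i => by
      have h := G.sum_laplacian_smul v i
      simp only [smul_eq_mul] at h
      rw [← h]
      exact congrFun hMv i
    have hvr : v r = 0 := by
      rw [dotProduct, Finset.sum_congr rfl fun i _ => by rw [hconst i], ← Finset.sum_mul, hγ1,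
        one_mul] at hγv
      exact hγv
    exact hv (funext fun i => (hconst i).trans hvr)
  have hsub : γ' - γ = 0 := by
    refine Matrix.eq_zero_of_vecMul_eq_zero hdet ?_
    rw [hM, Matrix.vecMul_add, Matrix.sub_vecMul, hγL, hγL', Matrix.vecMul_vecMulVec,
      dotProduct_one]
    simp [hγ1, hγ1']
  exact sub_eq_zero.1 hsub

end WeightedDigraph

/-! ### The operators `P ⊗ 1`, `1 ⊗ C` and their product. -/

section Operators

variable {n d : ℕ}

/-- The action of an `n × n` matrix on families of `n` opinion vectors. -/
noncomputable def mixOperator (d : ℕ) (P : Matrix (Fin n) (Fin n) ℝ) :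
    (Fin n → Fin d → ℝ) →L[ℝ] (Fin n → Fin d → ℝ) :=
  ContinuousLinearMap.pi fun i => ∑ j, P i j • ContinuousLinearMap.proj j

@[simp]
theorem mixOperator_apply (P : Matrix (Fin n) (Fin n) ℝ) (x : Fin n → Fin d → ℝ) (i : Fin n) :
    mixOperator d P x i = ∑ j, P i j • x j := by
  simp [mixOperator]

/-- The action of the logic matrix on each of `n` opinion vectors. -/
noncomputable def logicOperator (n : ℕ) (C : Matrix (Fin d) (Fin d) ℝ) :
    (Fin n → Fin d → ℝ) →L[ℝ] (Fin n → Fin d → ℝ) :=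
  ContinuousLinearMap.pi fun i =>
    (LinearMap.toContinuousLinearMap (Matrix.toLin' C)).comp (ContinuousLinearMap.proj i)

@[simp]
theorem logicOperator_apply (C : Matrix (Fin d) (Fin d) ℝ) (x : Fin n → Fin d → ℝ) (i : Fin n) :
    logicOperator n C x i = C *ᵥ x i := by
  simp [logicOperator]

theorem commute_mixOperator_logicOperator (P : Matrix (Fin n) (Fin n) ℝ)
    (C : Matrix (Fin d) (Fin d) ℝ) : Commute (mixOperator d P) (logicOperator n C) := by
  refine ContinuousLinearMap.ext fun x => funext fun i => ?_
  rw [mul_apply_eq_comp, mul_apply_eq_comp, mixOperator_apply, logicOperator_apply,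
    mixOperator_apply, Matrix.mulVec_sum]
  simp only [logicOperator_apply, Matrix.mulVec_smul]

theorem norm_mixOperator_apply_le {P : Matrix (Fin n) (Fin n) ℝ} (hP : ∀ i j, 0 ≤ P i j)
    (hP1 : ∀ i, ∑ j, P i j = 1) (x : Fin n → Fin d → ℝ) : ‖mixOperator d P x‖ ≤ ‖x‖ := by
  refine (pi_norm_le_iff_of_nonneg (norm_nonneg _)).2 fun i => ?_
  rw [mixOperator_apply]
  calc ‖∑ j, P i j • x j‖ ≤ ∑ j, ‖P i j • x j‖ := norm_sum_le _ _
    _ ≤ ∑ j, P i j * ‖x‖ := Finset.sum_le_sum fun j _ => by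
      rw [norm_smul, Real.norm_of_nonneg (hP i j)]
      exact mul_le_mul_of_nonneg_left (norm_le_pi_norm x j) (hP i j)
    _ = ‖x‖ := by rw [← Finset.sum_mul, hP1, one_mul]

theorem sum_abs_le_matrixInfNorm (C : Matrix (Fin d) (Fin d) ℝ) (k : Fin d) :
    ∑ l, |C k l| ≤ matrixInfNorm C := by
  rw [matrixInfNorm, Matrix.linfty_opNorm_def]
  have h := Finset.le_sup (f := fun i => ∑ l, ‖C i l‖₊) (Finset.mem_univ k)
  have h' := NNReal.coe_le_coe.2 h
  simpa using h'

/-- If the diagonal of `C` is at least `c`, then `C - c` has norm at most `‖C‖ - c`. -/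
theorem norm_mulVec_sub_smul_le {C : Matrix (Fin d) (Fin d) ℝ} (hC : matrixInfNorm C = 1)
    {c : ℝ} (hc1 : c ≤ 1) (hc : ∀ k, c ≤ C k k) (y : Fin d → ℝ) :
    ‖C *ᵥ y - c • y‖ ≤ (1 - c) * ‖y‖ := by
  refine (pi_norm_le_iff_of_nonneg (mul_nonneg (sub_nonneg.2 hc1) (norm_nonneg _))).2 fun k => ?_
  have h : (C *ᵥ y - c • y) k = ∑ l, (C k l - if k = l then c else 0) * y l := by
    simp [sub_mul, Matrix.mulVec, dotProduct]
  have habs : ∀ l, |C k l - if k = l then c else 0| ≤ |C k l| - if k = l then c else 0 :=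
    fun l => by
      split_ifs with hkl
      · subst hkl
        rw [abs_of_nonneg (sub_nonneg.2 (hc k))]
        exact sub_le_sub_right (le_abs_self _) _
      · simp
  rw [h, Real.norm_eq_abs]
  calc _ ≤ ∑ l, |(C k l - if k = l then c else 0) * y l| := Finset.abs_sum_le_sum_abs _ _
    _ ≤ ∑ l, (|C k l| - if k = l then c else 0) * ‖y‖ := Finset.sum_le_sum fun l _ => by
      rw [abs_mul]
      exact mul_le_mul (habs l) (norm_le_pi_norm y l) (abs_nonneg _) ((abs_nonneg _).trans (habs l))
    _ = (∑ l, |C k l| - c) * ‖y‖ := by rw [← Finset.sum_mul, Finset.sum_sub_distrib]; simp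
    _ ≤ (1 - c) * ‖y‖ := by
      gcongr
      exact (sum_abs_le_matrixInfNorm C k).trans hC.le

theorem norm_logicOperator_sub_smul_le {C : Matrix (Fin d) (Fin d) ℝ} (hC : matrixInfNorm C = 1)
    {c : ℝ} (hc1 : c ≤ 1) (hc : ∀ k, c ≤ C k k) (x : Fin n → Fin d → ℝ) :
    ‖logicOperator n C x - c • x‖ ≤ (1 - c) * ‖x‖ := by
  have h0 : 0 ≤ 1 - c := sub_nonneg.2 hc1
  refine (pi_norm_le_iff_of_nonneg (mul_nonneg h0 (norm_nonneg _))).2 fun i => ?_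
  rw [Pi.sub_apply, logicOperator_apply]
  exact (norm_mulVec_sub_smul_le hC hc1 hc (x i)).trans
    (mul_le_mul_of_nonneg_left (norm_le_pi_norm x i) h0)

theorem exists_pos_le_diag {C : Matrix (Fin d) (Fin d) ℝ} (hdiag : ∀ k, 0 < C k k) :
    ∃ c : ℝ, 0 < c ∧ c ≤ 1 ∧ ∀ k, c ≤ C k k := by
  rcases isEmpty_or_nonempty (Fin d) with h | h
  · exact ⟨1, one_pos, le_rfl, fun k => h.elim k⟩
  · obtain ⟨m, hm⟩ := Finite.exists_min fun k => C k k
    exact ⟨min (C m m) 1, lt_min (hdiag m) one_pos, min_le_right _ _,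
      fun k => (min_le_left _ _).trans (hm k)⟩

/-- The operator `A = (1 - L) ⊗ C`; the opinion dynamics are `x' = (A - 1) x`. -/
noncomputable def opinionOperator (G : WeightedDigraph n) (C : Matrix (Fin d) (Fin d) ℝ) :
    (Fin n → Fin d → ℝ) →L[ℝ] (Fin n → Fin d → ℝ) :=
  mixOperator d G.transition * logicOperator n C

theorem opinionOperator_apply (G : WeightedDigraph n) (C : Matrix (Fin d) (Fin d) ℝ)
    (x : Fin n → Fin d → ℝ) (i : Fin n) :
    opinionOperator G C x i = ∑ j, G.transition i j • (C *ᵥ x j) := by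
  simp [opinionOperator]

theorem opinionOperator_const (G : WeightedDigraph n) {C : Matrix (Fin d) (Fin d) ℝ}
    {z : Fin d → ℝ} (hz : C *ᵥ z = z) : opinionOperator G C (fun _ => z) = fun _ => z := by
  funext i
  rw [opinionOperator_apply, ← Finset.sum_smul, G.sum_transition, one_smul, hz]

theorem norm_opinionOperator_apply_le {G : WeightedDigraph n} {C : Matrix (Fin d) (Fin d) ℝ}
    (hL : ∀ i, G.laplacian i i ≤ 1) (hdiag : ∀ k, 0 < C k k) (hC : matrixInfNorm C = 1)
    (x : Fin n → Fin d → ℝ) : ‖opinionOperator G C x‖ ≤ ‖x‖ := by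
  -- The case `c = 0` of the bound says that `C` is a contraction.
  have h := norm_logicOperator_sub_smul_le hC zero_le_one (fun k => (hdiag k).le) x
  rw [zero_smul, sub_zero, sub_zero, one_mul] at h
  exact (norm_mixOperator_apply_le (G.transition_nonneg hL) G.sum_transition _).trans h

theorem WeightedDigraph.mem_neighbors (G : WeightedDigraph n) {i j : Fin n} :
    j ∈ G.neighbors i ↔ G.Edge j i := by
  classical simp [WeightedDigraph.neighbors]

theorem sum_neighbors (G : WeightedDigraph n) {E : Type*} [AddCommGroup E] [Module ℝ E]
    (f : Fin n → E) (i : Fin n) :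
    ∑ j ∈ G.neighbors i, G.A i j • f j = ∑ j, G.A i j • f j := by
  refine Finset.sum_subset (Finset.subset_univ _) fun j _ hj => ?_
  rw [G.mem_neighbors] at hj
  rw [WeightedDigraph.eq_zero_of_not_edge hj, zero_smul]

theorem opinionOperator_sub_one_apply (G : WeightedDigraph n) (C : Matrix (Fin d) (Fin d) ℝ)
    (x : Fin n → Fin d → ℝ) (i : Fin n) :
    (opinionOperator G C - 1) x i
      = (∑ j ∈ G.neighbors i, G.A i j • (C *ᵥ (x j - x i))) + (C - 1) *ᵥ x i := by
  have h : (opinionOperator G C - 1) x i = opinionOperator G C x i - x i := rfl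
  rw [h, opinionOperator_apply, sum_neighbors, G.sum_transition_smul, Matrix.sub_mulVec,
    Matrix.one_mulVec]
  have h' : ∑ j, G.A i j • (C *ᵥ (x j - x i)) = -∑ j, G.A i j • (C *ᵥ x i - C *ᵥ x j) := by
    rw [← Finset.sum_neg_distrib]
    exact Finset.sum_congr rfl fun j _ => by rw [Matrix.mulVec_sub, ← smul_neg, neg_sub]
  rw [h']
  abel

theorem isModel1Solution_iff {G : WeightedDigraph n} {C : Matrix (Fin d) (Fin d) ℝ}
    {x : ℝ → Fin n → Fin d → ℝ} : IsModel1Solution G C x ↔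
      ∀ t, 0 ≤ t → HasDerivWithinAt x ((opinionOperator G C - 1) (x t)) (Set.Ici 0) t := by
  simp only [IsModel1Solution, hasDerivWithinAt_pi (φ := x), opinionOperator_sub_one_apply]

theorem IsModel1Solution.eq_exp {G : WeightedDigraph n} {C : Matrix (Fin d) (Fin d) ℝ}
    {x : ℝ → Fin n → Fin d → ℝ} (hx : IsModel1Solution G C x) {t : ℝ} (ht : 0 ≤ t) :
    x t = NormedSpace.exp (t • (opinionOperator G C - 1)) (x 0) :=
  eq_exp_smul_apply (isModel1Solution_iff.1 hx) ht

theorem isModel1Solution_exp (G : WeightedDigraph n) (C : Matrix (Fin d) (Fin d) ℝ)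
    (x₀ : Fin n → Fin d → ℝ) :
    IsModel1Solution G C fun t => NormedSpace.exp (t • (opinionOperator G C - 1)) x₀ :=
  isModel1Solution_iff.2 fun t _ => (hasDerivAt_exp_smul_apply _ _ t).hasDerivWithinAt

/-- On a graph with a root, the fixed points of `(1 - L) ⊗ C` are the consensus states at
eigenvectors of `C` for the eigenvalue `1`. -/
theorem exists_eq_const_of_opinionOperator_fixed {G : WeightedDigraph n}
    {C : Matrix (Fin d) (Fin d) ℝ} (hL : ∀ i, G.laplacian i i ≤ 1) (hdiag : ∀ k, 0 < C k k)
    (hC : matrixInfNorm C = 1) (hr : ∃ r, G.IsRoot r) {x : Fin n → Fin d → ℝ}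
    (hx : opinionOperator G C x = x) : ∃ z, C *ᵥ z = z ∧ x = fun _ => z := by
  obtain ⟨r, hr⟩ := hr
  obtain ⟨c, hc0, hc1, hc⟩ := exists_pos_le_diag hdiag
  have hCx : logicOperator n C x = x :=
    fixed_of_mul_fixed (commute_mixOperator_logicOperator G.transition C)
      (norm_mixOperator_apply_le (G.transition_nonneg hL) G.sum_transition) hc0 hc1
      (norm_logicOperator_sub_smul_le hC hc1 hc) hx
  have hPx : mixOperator d G.transition x = x := by
    rw [opinionOperator, mul_apply_eq_comp, hCx] at hx
    exact hx
  refine ⟨x r, (logicOperator_apply C x r).symm.trans (congrFun hCx r), funext fun i =>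
    funext fun k => hr.eq_of_harmonic (v := fun i => x i k) (fun i => ?_) i⟩
  have h := congrFun (congrFun hPx i) k
  rw [mixOperator_apply, G.sum_transition_smul] at h
  simpa [Finset.sum_apply] using h

/-! ### Consensus and roots. -/

theorem opinionOperator_apply_eq_zero_of_closed {G : WeightedDigraph n}
    (C : Matrix (Fin d) (Fin d) ℝ) {S : Set (Fin n)} (hS : ∀ i j, G.Edge j i → i ∈ S → j ∈ S)
    {x : Fin n → Fin d → ℝ} (hx : ∀ i ∈ S, x i = 0) {i : Fin n} (hi : i ∈ S) :
    opinionOperator G C x i = 0 := by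
  rw [opinionOperator_apply]
  refine Finset.sum_eq_zero fun j _ => ?_
  by_cases hij : i = j
  · rw [← hij, hx i hi, Matrix.mulVec_zero, smul_zero]
  · by_cases he : G.Edge j i
    · rw [hx j (hS i j he hi), Matrix.mulVec_zero, smul_zero]
    · rw [G.transition_of_ne hij, WeightedDigraph.eq_zero_of_not_edge he, zero_smul]

/-- Opinions that vanish on a set without incoming edges from outside keep vanishing there. -/
theorem exp_apply_eq_zero_of_closed {G : WeightedDigraph n} (C : Matrix (Fin d) (Fin d) ℝ)
    {S : Set (Fin n)} (hS : ∀ i j, G.Edge j i → i ∈ S → j ∈ S) {x : Fin n → Fin d → ℝ}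
    (hx : ∀ i ∈ S, x i = 0) (t : ℝ) {i : Fin n} (hi : i ∈ S) :
    NormedSpace.exp (t • (opinionOperator G C - 1)) x i = 0 := by
  let W : Submodule ℝ (Fin n → Fin d → ℝ) :=
    { carrier := {x | ∀ i ∈ S, x i = 0}
      add_mem' := fun ha hb i hi => by rw [Pi.add_apply, ha i hi, hb i hi, add_zero]
      zero_mem' := fun _ _ => rfl
      smul_mem' := fun c x hx i hi => by rw [Pi.smul_apply, hx i hi, smul_zero] }
  have hmem : NormedSpace.exp (t • (opinionOperator G C - 1)) x ∈ W :=
    exp_apply_mem W.closed_of_finiteDimensional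
      (fun y hy => W.smul_mem t (W.sub_mem
        (fun i hi => opinionOperator_apply_eq_zero_of_closed C hS hy hi) hy)) hx
  exact hmem i hi

theorem tendsto_mul_exp_neg_mul (a b : ℝ) {α : ℝ} (hα : 0 < α) :
    Filter.Tendsto (fun t => a * Real.exp (-α * t) * b) Filter.atTop (nhds 0) := by
  have h : Filter.Tendsto (fun t => Real.exp (-α * t)) Filter.atTop (nhds 0) :=
    Real.tendsto_exp_atBot.comp (Filter.tendsto_id.const_mul_atTop_of_neg (neg_lt_zero.2 hα))
  simpa using (h.const_mul a).mul_const b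

open Classical in
theorem exists_isRoot_of_consensus {G : WeightedDigraph n} {C : Matrix (Fin d) (Fin d) ℝ}
    (hn : 0 < n) {z : Fin d → ℝ} (hz0 : z ≠ 0) (hz : C *ᵥ z = z)
    (h : ReachesConsensusGloballyExponentially G C) : ∃ r, G.IsRoot r := by
  by_contra hr
  obtain ⟨i, j, hij⟩ := G.exists_disjoint_ancestors hn hr
  obtain ⟨K, α, hα, hK⟩ := h
  have hclosed : ∀ i a b, G.Edge b a → a ∈ G.ancestors i → b ∈ G.ancestors i :=
    fun i a b hab ha => Relation.ReflTransGen.head hab ha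
  -- Both the opinions `x₀` on the ancestors of `j` and the difference `x₀ - z` on those of `i`
  -- vanish, and they continue to vanish; `z` itself is an equilibrium. Hence nodes `i` and `j` keep
  -- the opinions `z` and `0`.
  set x₀ : Fin n → Fin d → ℝ := fun a => if a ∈ G.ancestors i then z else 0 with hx₀
  set x := fun t : ℝ => NormedSpace.exp (t • (opinionOperator G C - 1)) x₀ with hx
  have hxj : ∀ t, x t j = 0 := fun t => by
    refine exp_apply_eq_zero_of_closed C (hclosed j) (fun a ha => ?_) t Relation.ReflTransGen.refl
    exact if_neg fun ha' => Set.disjoint_left.1 hij ha' ha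
  have hxi : ∀ t, x t i = z := fun t => by
    have h0 : NormedSpace.exp (t • (opinionOperator G C - 1)) (x₀ - fun _ => z) i = 0 := by
      refine exp_apply_eq_zero_of_closed C (hclosed i) (fun a ha => ?_) t
        Relation.ReflTransGen.refl
      rw [Pi.sub_apply, hx₀]
      simp only [if_pos ha, sub_self]
    rw [map_sub, Pi.sub_apply, sub_eq_zero] at h0
    refine h0.trans (congrFun (exp_smul_apply_of_apply_eq_zero ?_ t) i)
    exact sub_eq_zero.2 (opinionOperator_const G hz)
  have hle : ‖z‖ ≤ 0 :=
    ge_of_tendsto (tendsto_mul_exp_neg_mul K ‖x 0‖ hα) <|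
      (Filter.eventually_ge_atTop 0).mono fun t ht => by
        simpa only [hxi, hxj, sub_zero] using hK x (isModel1Solution_exp G C x₀) t ht i j
  exact hz0 (norm_le_zero_iff.1 hle)

/-- The limit is a fixed point of `A`, so all its components equal one `z`; comparing two nodes
through `z` costs the factor `2`. -/
theorem consensus_of_exists_isRoot {G : WeightedDigraph n}
    {C : Matrix (Fin d) (Fin d) ℝ} (hL : ∀ i, G.laplacian i i ≤ 1) (hdiag : ∀ k, 0 < C k k)
    (hC : matrixInfNorm C = 1) (hr : ∃ r, G.IsRoot r) :
    ReachesConsensusGloballyExponentially G C := by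
  have hA := norm_opinionOperator_apply_le hL hdiag hC
  obtain ⟨Q, hQ⟩ := exists_isFixedSpaceProjection hA
  obtain ⟨K, α, hα, hK⟩ := hQ.exists_exponential_bound hA
  refine ⟨2 * K, α, hα, fun x hx t ht i j => ?_⟩
  obtain ⟨z, -, hz⟩ :=
    exists_eq_const_of_opinionOperator_fixed hL hdiag hC hr (hQ.apply_left (x 0))
  have h := hK (x 0) t ht
  rw [← hx.eq_exp ht, hz] at h
  set w : Fin n → Fin d → ℝ := x t - fun _ => z
  calc ‖x t i - x t j‖ = ‖w i - w j‖ := by simp [w]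
    _ ≤ ‖w‖ + ‖w‖ := (norm_sub_le _ _).trans
      (add_le_add (norm_le_pi_norm w i) (norm_le_pi_norm w j))
    _ ≤ 2 * K * Real.exp (-α * t) * ‖x 0‖ := by linarith

/-! ### Identification of the limit. -/

theorem sum_vecMulVec_mulVec {p : ℕ} (ζ ξ : Fin p → Fin d → ℝ) (y : Fin d → ℝ) :
    (∑ r, Matrix.vecMulVec (ζ r) (ξ r)) *ᵥ y = ∑ r, (ξ r ⬝ᵥ y) • ζ r := by
  rw [Matrix.sum_mulVec]
  exact Finset.sum_congr rfl fun r _ => by rw [Matrix.vecMulVec_mulVec, op_smul_eq_smul]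

theorem IsDualEigenvectorFamily.dotProduct_sum {p : ℕ} {C : Matrix (Fin d) (Fin d) ℝ}
    {ζ ξ : Fin p → Fin d → ℝ} (h : IsDualEigenvectorFamily C ζ ξ) (c : Fin p → ℝ) (r : Fin p) :
    ξ r ⬝ᵥ ∑ s, c s • ζ s = c r := by
  simp [_root_.dotProduct_sum, h.dual]

/-- Eigenvectors of `C` for the eigenvalue `1` are reproduced by `∑ ζ_r ξ_rᵀ` if the dual families
are as long as the multiplicity of the eigenvalue. -/
theorem IsDualEigenvectorFamily.sum_eq_self {p : ℕ} {C : Matrix (Fin d) (Fin d) ℝ}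
    {ζ ξ : Fin p → Fin d → ℝ} (h : IsDualEigenvectorFamily C ζ ξ)
    (hp : Module.finrank ℝ (Module.End.eigenspace (Matrix.toLin' C) (1 : ℝ)) = p)
    {z : Fin d → ℝ} (hz : C *ᵥ z = z) : ∑ r, (ξ r ⬝ᵥ z) • ζ r = z := by
  have hli : LinearIndependent ℝ ζ := Fintype.linearIndependent_iff.2 fun c hc r => by
    rw [← h.dotProduct_sum c r, hc, dotProduct_zero]
  have hmem : ∀ y, C *ᵥ y = y → y ∈ Module.End.eigenspace (Matrix.toLin' C) (1 : ℝ) :=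
    fun y hy => by rw [Module.End.mem_eigenspace_iff, Matrix.toLin'_apply, hy, one_smul]
  have hspan : Submodule.span ℝ (Set.range ζ) = Module.End.eigenspace (Matrix.toLin' C) 1 := by
    refine Submodule.eq_of_le_of_finrank_eq (Submodule.span_le.2 ?_) ?_
    · rintro _ ⟨r, rfl⟩
      exact hmem _ (h.right r)
    · rw [finrank_span_eq_card hli, hp, Fintype.card_fin]
  obtain ⟨c, rfl⟩ := (Submodule.mem_span_range_iff_exists_fun ℝ).1 (hspan ▸ hmem z hz)
  simp only [h.dotProduct_sum]

/-- The map that sends the initial opinions to the predicted consensus state. -/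
noncomputable def finalOperator {p : ℕ} (γ : Fin n → ℝ) (ζ ξ : Fin p → Fin d → ℝ) :
    (Fin n → Fin d → ℝ) →L[ℝ] (Fin n → Fin d → ℝ) :=
  LinearMap.toContinuousLinearMap
    { toFun := fun x _ => finalOpinion γ ζ ξ x
      map_add' := fun x y => by
        funext i
        simp [finalOpinion, Finset.sum_add_distrib, Matrix.mulVec_add]
      map_smul' := fun c x => by
        funext i
        simp [finalOpinion, smul_comm _ c, ← Finset.smul_sum, Matrix.mulVec_smul] }

/-- As `γ` is stationary for `P`, the `γ`-average of `A x` is `C` applied to that of `x`, and the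
left eigenvectors absorb `C`. Constant states at eigenvectors are reproduced because `p` is the
dimension of the eigenspace. -/
theorem isFixedSpaceProjection_finalOperator {p : ℕ} {G : WeightedDigraph n}
    {C : Matrix (Fin d) (Fin d) ℝ} (hL : ∀ i, G.laplacian i i ≤ 1) (hdiag : ∀ k, 0 < C k k)
    (hC : matrixInfNorm C = 1) (hr : ∃ r, G.IsRoot r) {γ : Fin n → ℝ}
    (hγ : G.IsNormalizedLeftNullVector γ) {ζ ξ : Fin p → Fin d → ℝ}
    (h : IsDualEigenvectorFamily C ζ ξ)
    (hp : Module.finrank ℝ (Module.End.eigenspace (Matrix.toLin' C) (1 : ℝ)) = p) :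
    IsFixedSpaceProjection (opinionOperator G C) (finalOperator γ ζ ξ) := by
  obtain ⟨-, hγL, hγ1⟩ := hγ
  have happly : ∀ x, finalOperator γ ζ ξ x = fun _ => ∑ r, (ξ r ⬝ᵥ ∑ j, γ j • x j) • ζ r :=
    fun x => funext fun _ => sum_vecMulVec_mulVec ζ ξ _
  have hconst : ∀ z : Fin d → ℝ, ∑ j : Fin n, γ j • z = z := fun z => by
    rw [← Finset.sum_smul, hγ1, one_smul]
  refine ⟨fun x => ?_, fun x => ?_, fun x => ?_, fun x hx hQx => ?_⟩
  · rw [happly]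
    refine opinionOperator_const G ?_
    simp only [Matrix.mulVec_sum, Matrix.mulVec_smul, h.right]
  · have hsum : ∑ i, γ i • opinionOperator G C x i = C *ᵥ ∑ j, γ j • x j := by
      simp only [opinionOperator_apply, Finset.smul_sum, smul_smul]
      rw [Finset.sum_comm, Matrix.mulVec_sum]
      refine Finset.sum_congr rfl fun j _ => ?_
      rw [← Finset.sum_smul, G.sum_mul_transition, hγL, Pi.zero_apply, sub_zero,
        Matrix.mulVec_smul]
    rw [happly, happly, hsum]
    simp only [Matrix.dotProduct_mulVec, h.left]
  · rw [happly (finalOperator γ ζ ξ x), happly x]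
    simp only [hconst, h.dotProduct_sum]
  · obtain ⟨z, hz, rfl⟩ := exists_eq_const_of_opinionOperator_fixed hL hdiag hC hr hx
    rw [happly] at hQx
    simpa only [hconst, h.sum_eq_self hp hz] using hQx

end Operators

/-! ### The main theorem. -/

theorem mainTheorem6 {n d p : ℕ} (hn : 0 < n) (G : WeightedDigraph n)
    (C : Matrix (Fin d) (Fin d) ℝ) (hC : IsLogicMatrix C p)
    (hL : ∀ i, G.laplacian i i ≤ 1) (hdiag : ∀ k, 0 < C k k) (hnorm : matrixInfNorm C = 1) :
    (ReachesConsensusGloballyExponentially G C ↔ G.HasDirectedSpanningTree) ∧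
    (G.HasDirectedSpanningTree →
      ∃ γ : Fin n → ℝ, G.IsNormalizedLeftNullVector γ ∧
        (∀ γ' : Fin n → ℝ, G.IsNormalizedLeftNullVector γ' → γ' = γ) ∧
        ∀ ζ ξ : Fin p → Fin d → ℝ, IsDualEigenvectorFamily C ζ ξ →
          (∀ x : ℝ → Fin n → Fin d → ℝ, IsModel1Solution G C x → ∀ i : Fin n,
            Filter.Tendsto (fun t => x t i) Filter.atTop (nhds (finalOpinion γ ζ ξ (x 0)))) ∧
          ∃ K α : ℝ, 0 < α ∧ ∀ x : ℝ → Fin n → Fin d → ℝ, IsModel1Solution G C x →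
            ∀ t : ℝ, 0 ≤ t → ∀ i : Fin n,
              ‖x t i - finalOpinion γ ζ ξ (x 0)‖ ≤ K * Real.exp (-α * t) * ‖x 0‖) := by
  rw [G.hasDirectedSpanningTree_iff]
  refine ⟨⟨fun h => ?_, consensus_of_exists_isRoot hL hdiag hnorm⟩, fun hr => ?_⟩
  · have hpos : 0 < Module.finrank ℝ (Module.End.eigenspace (Matrix.toLin' C) (1 : ℝ)) :=
      hC.geometric_multiplicity ▸ hC.one_le
    have := Module.finrank_pos_iff.1 hpos
    obtain ⟨⟨z, hz⟩, hz0⟩ := exists_ne (0 : Module.End.eigenspace (Matrix.toLin' C) (1 : ℝ))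
    rw [Module.End.mem_eigenspace_iff, Matrix.toLin'_apply, one_smul] at hz
    exact exists_isRoot_of_consensus hn (fun h => hz0 (Subtype.ext h)) hz h
  · obtain ⟨γ, hγ⟩ := G.exists_isNormalizedLeftNullVector hn hL
    refine ⟨γ, hγ, fun γ' hγ' => hr.elim fun r hr =>
      hr.eq_of_isNormalizedLeftNullVector hγ hγ', fun ζ ξ h => ?_⟩
    have hQ := isFixedSpaceProjection_finalOperator hL hdiag hnorm hr hγ h
      hC.geometric_multiplicity
    obtain ⟨K, α, hα, hK⟩ :=
      hQ.exists_exponential_bound (norm_opinionOperator_apply_le hL hdiag hnorm)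
    have hbound : ∀ x : ℝ → Fin n → Fin d → ℝ, IsModel1Solution G C x → ∀ t : ℝ, 0 ≤ t →
        ∀ i : Fin n, ‖x t i - finalOpinion γ ζ ξ (x 0)‖ ≤ K * Real.exp (-α * t) * ‖x 0‖ :=
      fun x hx t ht i => by
        have h := hK (x 0) t ht
        rw [← hx.eq_exp ht] at h
        exact (norm_le_pi_norm (x t - finalOperator γ ζ ξ (x 0)) i).trans h
    refine ⟨fun x hx i => ?_, K, α, hα, hbound⟩
    rw [tendsto_iff_norm_sub_tendsto_zero]
    exact squeeze_zero' (Filter.Eventually.of_forall fun t => norm_nonneg _)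
      ((Filter.eventually_ge_atTop 0).mono fun t ht => hbound x hx t ht i)
      (tendsto_mul_exp_neg_mul K ‖x 0‖ hα)
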